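/- Let $\beta\in(1,2)$, let $\Sigma=\{0,1\}^{\mathbb N}$, let $I_\beta=[0,\frac1{\beta-1}]$, and let $\pi_\beta:\Sigma\to I_\beta$, $\pi_\beta(\underline a)=\sum_{i\ge1}a_i\beta^{-i}$. For $x\in\mathbb R$ let $\mathcal E_\beta(x)=\pi_\beta^{-1}(x)$ be the set of $\beta$-expansions of $x$. Let $m$ be the $(\frac12,\frac12)$ Bernoulli (product) measure on $\Sigma$ and let $\nu_\beta=m\circ\pi_\beta^{-1}$ be the Bernoulli convolution. Put $s=\frac{\log(2/\beta)}{\log 2}$ and let $\mathcal H^s$ be the $s$-dimensional Hausdorff measure on $\Sigma$ for the metric $d(\underline a,\underline b)=2^{-n}$ if $\underline a\neq\underline b$ and $n\ge 0$ is the length of their longest common prefix, $d(\underline a,\underline a)=0$. A disintegration of $m$ over the fibres $\mathcal E_\beta(x)$ is a family $(m_x)$ of measures on $\Sigma$, indexed by real $x$, such that for $\nu_\beta$-almost every $x$ the measure $m_x$ is a probability measure with $m_x(\Sigma\setminus\mathcal E_\beta(x))=0$, and such that for every $m$-integrable $f:\Sigma\to\mathbb R$ the function $f$ is $m_x$-integrable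 for $\nu_\beta$-almost every $x$, the function $x\mapsto\int f\,dm_x$ is $\nu_\beta$-integrable, and $\int_\Sigma f\,dm=\int\left(\int f\,dm_x\right)d\nu_\beta(x)$. **Theorem.** (1) One has $\mathcal H^s(\mathcal E_\beta(x))>0$ for Lebesgue almost every $x\in I_\beta$ if and only if $\nu_\beta$ is absolutely continuous with respect to Lebesgue measure with essentially bounded density. (2) Suppose that $\nu_\beta$ is absolutely continuous with essentially bounded density. Then $\mathcal H^s(\mathcal E_\beta(x))<\infty$ for Lebesgue almost every $x\in I_\beta$; the family of normalised Hausdorff measures $$x\mapsto\frac{\mathcal H^s|_{\mathcal E_\beta(x)}}{\mathcal H^s(\mathcal E_\beta(x))}$$ is a disintegration of $m$ over the fibres $\mathcal E_\beta(x)$; and for every disintegration $(m_x)$ of $m$ over these fibres, $m_x=\mathcal H^s|_{\mathcal E_\beta(x)}/\mathcal H^s(\mathcal E_\beta(x))$ for Lebesgue almost every $x\in I_\beta$. -/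

import Mathlib

open MeasureTheory
open scoped ENNReal NNReal

noncomputable section

namespace BetaExpansion

/-- The space `{0,1}^ℕ` of digit sequences, with the product topology and the product `σ`-algebra.
The entry with index `i : ℕ` is the digit usually written `a_{i+1}`. -/
abbrev Seq : Type := ℕ → Fin 2

/-- The value `∑_{i ≥ 1} a_i β^{-i}` of a digit sequence. -/
def value (β : ℝ) (a : Seq) : ℝ := ∑' i : ℕ, ((a i : ℕ) : ℝ) * (β⁻¹) ^ (i + 1)

/-- The set of `β`-expansions of `x`. -/
def expansions (β x : ℝ) : Set Seq := {a | value β a = x}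

/-- The interval `I_β = [0, 1/(β-1)]`. -/
def interval (β : ℝ) : Set ℝ := Set.Icc 0 (1 / (β - 1))

/-- The `(1/2,1/2)` Bernoulli measure on `{0,1}^ℕ`. -/
def uniformBernoulli : Measure Seq :=
  Measure.infinitePi fun _ : ℕ => (PMF.uniformOfFintype (Fin 2)).toMeasure

/-- The Bernoulli convolution: the image of the Bernoulli measure under `value β`. -/
def convolution (β : ℝ) : Measure ℝ := uniformBernoulli.map (value β)

/-- `ν_β` is absolutely continuous and its density is essentially bounded. -/
def HasBoundedDensity (β : ℝ) : Prop :=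
  convolution β ≪ volume ∧
    ∃ c : ℝ≥0, ∀ᵐ x ∂volume.restrict (interval β), (convolution β).rnDeriv volume x ≤ c

/-- The `s`-dimensional Hausdorff measure on `{0,1}^ℕ` for the metric
`d(a,b) = 2^{-n}`, `n` the length of the longest common prefix of `a ≠ b`
(so that a cylinder given by `n` digits has diameter `2^{-n}`). -/
def hausdorff (s : ℝ) : Measure Seq :=
  letI : MetricSpace Seq := PiNat.metricSpace
  Measure.hausdorffMeasure s

/-- The exponent `log (2/β) / log 2`. -/
def dimension (β : ℝ) : ℝ := Real.log (2 / β) / Real.log 2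

/-- Normalised `log (2/β) / log 2`-dimensional Hausdorff measure on the set of `β`-expansions
of `x`. -/
def normalisedHausdorff (β x : ℝ) : Measure Seq :=
  (hausdorff (dimension β) (expansions β x))⁻¹ •
    (hausdorff (dimension β)).restrict (expansions β x)

/-- `M` is a disintegration of the Bernoulli measure over the fibres `expansions β x`: for
`ν_β`-almost every `x`, `M x` is a probability measure carried by the fibre over `x`, and
`∫ f dm = ∫ (∫ f dM_x) dν_β(x)` for all integrable `f` (with existence of the integrals
on the right). -/
structure IsDisintegration (β : ℝ) (M : ℝ → Measure Seq) : Prop where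
  isProbabilityMeasure : ∀ᵐ x ∂convolution β, IsProbabilityMeasure (M x)
  supported : ∀ᵐ x ∂convolution β, M x (expansions β x)ᶜ = 0
  integrable_fibre : ∀ f : Seq → ℝ, Integrable f uniformBernoulli →
    ∀ᵐ x ∂convolution β, Integrable f (M x)
  integrable_base : ∀ f : Seq → ℝ, Integrable f uniformBernoulli →
    Integrable (fun x => ∫ a, f a ∂M x) (convolution β)
  integral_eq : ∀ f : Seq → ℝ, Integrable f uniformBernoulli →
    ∫ a, f a ∂uniformBernoulli = ∫ x, (∫ a, f a ∂M x) ∂convolution β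

end BetaExpansion

end

/-!
Write `h x` for the `s`-dimensional Hausdorff measure of the fibre over `x`, with `s = dimension β`,
so that `2 ^ (-s) = β / 2`. Prepending a digit to a set of sequences multiplies its Hausdorff measure
by `β / 2`, and the part of the fibre over `x` lying in a cylinder of length `n` is a copy of the
whole fibre over an affine image of `x` of slope `β ^ n`. Integrating over `x`, a cylinder of
length `n` receives the share `(β / 2) ^ n * β ^ (-n) = 2 ^ (-n)` of `c = ∫ h`: the integral of the
Hausdorff measures on the fibres is `c` times the Bernoulli measure
(`withDensity_bind_normalisedHausdorff`). Hence `c • ν = h dx` for the Bernoulli convolution `ν`, and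
everything turns on whether `c`, which is always finite, is positive.

* If `c > 0`, then `h` is bounded. The upper density bound for Hausdorff measure says that almost
  every point of a fibre has, eventually, cylinders of relative weight less than `2`. These weights
  are the values of `h` along the orbit under the shift, so by Poincaré recurrence `h < 2` almost
  everywhere (`ae_fibreSize_lt_two`), and `ν = c⁻¹ h dx` has bounded density.
* If `c > 0`, then `h > 0` almost everywhere on the interval: the zero set of `h` is invariant under
  the expanding affine maps above, and Lebesgue's density theorem makes it null or of full measure
  (`ae_fibreSize_pos`).
* If `ν` has bounded density, then the conditional distributions of the Bernoulli measure on the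
  fibres, weighted by the density, give mass at most a constant times `(β / 2) ^ n` to a cylinder of
  length `n`. The mass distribution principle yields `h > 0` on a set of positive measure, so `c > 0`
  (`totalSize_ne_zero_of_hasBoundedDensity`).

When `c > 0`, dividing by `c` turns the formula for the integrated Hausdorff measures into the
disintegration of the Bernoulli measure into normalised Hausdorff measures. Uniqueness of
disintegrations is tested on the countably many cylinders, and null sets of `ν` are Lebesgue null
in the interval because `h > 0` there.
-/

namespace BetaExpansion

open PiNat Filter Topology ProbabilityTheory

/-! ### Cylinders, the shift and the Bernoulli measure -/

/-- Prepend a digit to a digit sequence. -/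
def cons (d : Fin 2) (a : Seq) : Seq
  | 0 => d
  | n + 1 => a n

/-- Delete the first digit of a digit sequence. -/
def shift (a : Seq) : Seq := fun n => a (n + 1)

@[simp] lemma cons_zero (d : Fin 2) (a : Seq) : cons d a 0 = d := rfl

@[simp] lemma cons_succ (d : Fin 2) (a : Seq) (n : ℕ) : cons d a (n + 1) = a n := rfl

@[simp] lemma shift_cons (d : Fin 2) (a : Seq) : shift (cons d a) = a := rfl

lemma cons_shift (a : Seq) : cons (a 0) (shift a) = a := by
  funext n; cases n <;> rfl

lemma cons_injective (d : Fin 2) : Function.Injective (cons d) := fun a b h => by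
  simpa using congrArg shift h

lemma measurable_cons (d : Fin 2) : Measurable (cons d) :=
  measurable_pi_lambda _ fun n => by
    cases n
    · exact measurable_const
    · exact measurable_pi_apply _

lemma continuous_shift : Continuous shift := continuous_pi fun n => continuous_apply (n + 1)

lemma measurable_shift : Measurable shift := continuous_shift.measurable

lemma preimage_cons_cylinder (d : Fin 2) (a : Seq) (n : ℕ) :
    cons d ⁻¹' PiNat.cylinder a (n + 1) = if d = a 0 then PiNat.cylinder (shift a) n else ∅ := by
  ext b
  have key : cons d b ∈ PiNat.cylinder a (n + 1) ↔ d = a 0 ∧ b ∈ PiNat.cylinder (shift a) n := by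
    simp only [mem_cylinder_iff]
    refine ⟨fun h => ⟨h 0 n.succ_pos, fun i hi => h (i + 1) (by omega)⟩, fun h i hi => ?_⟩
    cases i with
    | zero => exact h.1
    | succ i => exact h.2 i (by omega)
  rw [Set.mem_preimage, key]
  split_ifs with hd <;> simp [hd]

lemma measurableSet_cylinder (a : Seq) (n : ℕ) : MeasurableSet (PiNat.cylinder a n) :=
  (isOpen_cylinder _ a n).measurableSet

/-- The set of all cylinders, together with the empty set. -/
def cylinders : Set (Set Seq) := insert ∅ {s | ∃ (a : Seq) (n : ℕ), s = PiNat.cylinder a n}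

lemma countable_cylinders : cylinders.Countable := by
  refine Set.Countable.insert _ ?_
  have : {s : Set Seq | ∃ (a : Seq) (n : ℕ), s = PiNat.cylinder a n} =
      ⋃ n : ℕ, Set.range fun a : Seq => PiNat.cylinder a n := by
    ext s
    simp only [Set.mem_ofPred_eq, Set.mem_iUnion, Set.mem_range]
    exact ⟨fun ⟨a, n, h⟩ => ⟨n, a, h.symm⟩, fun ⟨n, a, h⟩ => ⟨a, n, h.symm⟩⟩
  rw [this]
  refine Set.countable_iUnion fun n => ?_
  have hsub : (Set.range fun a : Seq => PiNat.cylinder a n) ⊆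
      Set.range fun w : Fin n → Fin 2 => {b : Seq | ∀ i : Fin n, b i = w i} := by
    rintro _ ⟨a, rfl⟩
    refine ⟨fun i => a i, ?_⟩
    ext b
    simp only [Set.mem_ofPred_eq, mem_cylinder_iff]
    exact ⟨fun h i hi => h ⟨i, hi⟩, fun h i => h i i.2⟩
  exact (Set.countable_range _).mono hsub

lemma isPiSystem_cylinders : IsPiSystem cylinders := by
  rintro _ (rfl | ⟨a, n, rfl⟩) _ (rfl | ⟨b, m, rfl⟩) hne
  · simp at hne
  · simp at hne
  · simp at hne
  · obtain ⟨x, hxa, hxb⟩ := hne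
    rw [mem_cylinder_iff_eq] at hxa hxb
    rw [← hxa, ← hxb]
    rcases le_total n m with h | h
    · rw [Set.inter_eq_right.2 (cylinder_anti x h)]
      exact Or.inr ⟨x, m, rfl⟩
    · rw [Set.inter_eq_left.2 (cylinder_anti x h)]
      exact Or.inr ⟨x, n, rfl⟩

lemma generateFrom_cylinders :
    (MeasurableSpace.pi : MeasurableSpace Seq) = MeasurableSpace.generateFrom cylinders := by
  rw [cylinders, MeasurableSpace.generateFrom_insert_empty,
    ← (isTopologicalBasis_cylinders fun _ : ℕ => Fin 2).borel_eq_generateFrom]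
  exact BorelSpace.measurable_eq

/-- Two finite measures on sequences agree as soon as they agree on cylinders. -/
lemma measure_ext_cylinder {μ ν : Measure Seq} [IsFiniteMeasure μ]
    (h : ∀ a n, μ (PiNat.cylinder a n) = ν (PiNat.cylinder a n)) : μ = ν := by
  refine ext_of_generate_finite _ generateFrom_cylinders isPiSystem_cylinders ?_ ?_
  · rintro _ (rfl | ⟨a, n, rfl⟩)
    · simp
    · exact h a n
  · simpa using h 0 0

instance : IsProbabilityMeasure uniformBernoulli := by
  unfold uniformBernoulli; infer_instance

lemma uniformBernoulli_cylinder (a : Seq) (n : ℕ) :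
    uniformBernoulli (PiNat.cylinder a n) = 2⁻¹ ^ n := by
  have h : PiNat.cylinder a n = (↑(Finset.range n) : Set ℕ).pi fun i => {a i} := by
    rw [cylinder_eq_pi]
  rw [h, uniformBernoulli, Measure.infinitePi_pi]
  · simp
  · intro i _; exact MeasurableSet.singleton _

/-- Self-similarity of the Bernoulli measure: the first digit is a fair coin independent of the
remaining digits. -/
lemma uniformBernoulli_eq :
    uniformBernoulli = (2⁻¹ : ℝ≥0∞) • ∑ d : Fin 2, uniformBernoulli.map (cons d) := by
  refine measure_ext_cylinder fun a n => ?_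
  cases n with
  | zero =>
    have : ∀ d, IsProbabilityMeasure (uniformBernoulli.map (cons d)) := fun d =>
      Measure.isProbabilityMeasure_map (measurable_cons d).aemeasurable
    simp [cylinder_zero, ENNReal.inv_two_add_inv_two]
  | succ n =>
    simp only [Measure.smul_apply, Measure.finsetSum_apply, smul_eq_mul,
      Measure.map_apply (measurable_cons _) (measurableSet_cylinder _ _), preimage_cons_cylinder]
    simp only [apply_ite (uniformBernoulli), measure_empty, uniformBernoulli_cylinder,
      Finset.sum_ite_eq', Finset.mem_univ, if_true, pow_succ']

lemma uniformBernoulli_apply {A : Set Seq} (hA : MeasurableSet A) :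
    uniformBernoulli A = 2⁻¹ * ∑ d : Fin 2, uniformBernoulli (cons d ⁻¹' A) := by
  conv_lhs => rw [uniformBernoulli_eq]
  simp only [Measure.smul_apply, Measure.finsetSum_apply, smul_eq_mul,
    Measure.map_apply (measurable_cons _) hA]

lemma measurePreserving_shift : MeasurePreserving shift uniformBernoulli uniformBernoulli := by
  refine ⟨measurable_shift, Measure.ext fun A hA => ?_⟩
  rw [Measure.map_apply measurable_shift hA, uniformBernoulli_apply (measurable_shift hA)]
  simp only [← Set.preimage_comp]
  have : ∀ d, shift ∘ cons d = id := fun d => funext fun a => shift_cons d a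
  simp [this, ← mul_assoc, ENNReal.inv_mul_cancel]

/-! ### The value map -/

lemma summable_inv_pow_succ {β : ℝ} (hβ : 1 < β) : Summable fun i : ℕ => β⁻¹ ^ (i + 1) :=
  (summable_nat_add_iff 1).2
    (summable_geometric_of_lt_one (by positivity) (inv_lt_one_of_one_lt₀ hβ))

lemma digit_mul_inv_pow_le {β : ℝ} (hβ : 1 < β) (a : Seq) (i : ℕ) :
    ((a i : ℕ) : ℝ) * β⁻¹ ^ (i + 1) ≤ β⁻¹ ^ (i + 1) := by
  have : ((a i : ℕ) : ℝ) ≤ 1 := by exact_mod_cast Nat.le_of_lt_succ (a i).2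
  exact mul_le_of_le_one_left (by positivity) this

lemma continuous_value {β : ℝ} (hβ : 1 < β) : Continuous (value β) := by
  refine continuous_tsum (fun i => ?_) (summable_inv_pow_succ hβ) fun i a => ?_
  · exact (continuous_of_discreteTopology (f := fun d : Fin 2 => ((d : ℕ) : ℝ))).comp
      (continuous_apply i) |>.mul continuous_const
  · rw [Real.norm_of_nonneg (by positivity)]
    exact digit_mul_inv_pow_le hβ a i

lemma measurable_value {β : ℝ} (hβ : 1 < β) : Measurable (value β) :=
  (continuous_value hβ).measurable

lemma summable_value {β : ℝ} (hβ : 1 < β) (a : Seq) :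
    Summable fun i : ℕ => ((a i : ℕ) : ℝ) * β⁻¹ ^ (i + 1) :=
  Summable.of_nonneg_of_le (fun i => by positivity) (digit_mul_inv_pow_le hβ a)
    (summable_inv_pow_succ hβ)

lemma value_cons {β : ℝ} (hβ : 1 < β) (d : Fin 2) (a : Seq) :
    value β (cons d a) = ((d : ℕ) + value β a) * β⁻¹ := by
  rw [value, (summable_value hβ _).tsum_eq_zero_add, value, add_mul, ← tsum_mul_right]
  simp [pow_succ, mul_assoc]

lemma value_mem_interval {β : ℝ} (hβ : 1 < β) (a : Seq) : value β a ∈ interval β := by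
  refine ⟨tsum_nonneg fun i => by positivity, ((summable_value hβ a).tsum_le_tsum
    (digit_mul_inv_pow_le hβ a) (summable_inv_pow_succ hβ)).trans_eq ?_⟩
  simp only [pow_succ]
  rw [tsum_mul_right, tsum_geometric_of_lt_one (by positivity) (inv_lt_one_of_one_lt₀ hβ)]
  have : β - 1 ≠ 0 := by linarith
  have : β ≠ 0 := by linarith
  field_simp

lemma expansions_eq_empty {β x : ℝ} (hβ : 1 < β) (hx : x ∉ interval β) :
    expansions β x = ∅ :=
  Set.eq_empty_of_forall_notMem fun a ha => hx (by
    have ha : value β a = x := ha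
    exact ha ▸ value_mem_interval hβ a)

lemma isClosed_expansions {β : ℝ} (hβ : 1 < β) (x : ℝ) : IsClosed (expansions β x) :=
  isClosed_eq (continuous_value hβ) continuous_const

lemma measurableSet_expansions {β : ℝ} (hβ : 1 < β) (x : ℝ) : MeasurableSet (expansions β x) :=
  (isClosed_expansions hβ x).measurableSet

/-- The remainder of `x` after the first `n` digits of `a` have been read off: the point `y` such
that `x = ∑_{i < n} a_i β^{-(i+1)} + β^{-n} y`. -/
def remainder (β : ℝ) (a : Seq) : ℕ → ℝ → ℝ
  | 0, x => x
  | n + 1, x => remainder β (shift a) n (β * x - (a 0 : ℕ))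

lemma cons_mem_expansions {β : ℝ} (hβ : 1 < β) (d : Fin 2) (b : Seq) (x : ℝ) :
    cons d b ∈ expansions β x ↔ b ∈ expansions β (β * x - (d : ℕ)) := by
  have h0 : β ≠ 0 := by linarith
  simp only [expansions, Set.mem_ofPred_eq, value_cons hβ]
  constructor
  · rintro rfl; field_simp; ring
  · intro h; rw [h]; field_simp; ring

lemma expansions_inter_cylinder_succ {β : ℝ} (hβ : 1 < β) (x : ℝ) (a : Seq) (n : ℕ) :
    expansions β x ∩ PiNat.cylinder a (n + 1) =
      cons (a 0) '' (expansions β (β * x - (a 0 : ℕ)) ∩ PiNat.cylinder (shift a) n) := by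
  ext b
  constructor
  · rintro ⟨hb, hb'⟩
    have h0 : b 0 = a 0 := mem_cylinder_iff.1 hb' 0 n.succ_pos
    have hbs : cons (a 0) (shift b) = b := by rw [← h0, cons_shift]
    refine ⟨shift b, ⟨?_, ?_⟩, hbs⟩
    · rwa [← cons_mem_expansions hβ, hbs]
    · exact mem_cylinder_iff.2 fun i hi => mem_cylinder_iff.1 hb' (i + 1) (by omega)
  · rintro ⟨c, ⟨hc, hc'⟩, rfl⟩
    refine ⟨(cons_mem_expansions hβ _ _ _).2 hc, ?_⟩
    have : c ∈ cons (a 0) ⁻¹' PiNat.cylinder a (n + 1) := by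
      simpa [preimage_cons_cylinder] using hc'
    exact this

lemma remainder_value {β : ℝ} (hβ : 1 < β) (a : Seq) (n : ℕ) :
    remainder β a n (value β a) = value β (shift^[n] a) := by
  induction n generalizing a with
  | zero => rfl
  | succ n ih =>
    have h0 : β ≠ 0 := by linarith
    have : β * value β a - (a 0 : ℕ) = value β (shift a) := by
      conv_lhs => rw [← cons_shift a, value_cons hβ]
      rw [cons_zero]; field_simp; ring
    rw [remainder, this, ih, Function.iterate_succ_apply]

/-- The remainder map is affine of slope `β ^ n`. -/
lemma remainder_eq (β : ℝ) (a : Seq) (n : ℕ) (x : ℝ) :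
    remainder β a n x = β ^ n * x + remainder β a n 0 := by
  induction n generalizing a x with
  | zero => simp [remainder]
  | succ n ih => rw [remainder, ih, remainder, ih (shift a) (β * 0 - _)]; ring

lemma measurable_remainder (β : ℝ) (a : Seq) (n : ℕ) : Measurable (remainder β a n) := by
  rw [show remainder β a n = fun x => β ^ n * x + remainder β a n 0 from
    funext (remainder_eq β a n)]
  fun_prop

lemma lintegral_remainder {β : ℝ} (hβ : 1 < β) (a : Seq) (n : ℕ) {f : ℝ → ℝ≥0∞}
    (hf : Measurable f) :
    ∫⁻ x, f (remainder β a n x) = ENNReal.ofReal β⁻¹ ^ n * ∫⁻ y, f y := by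
  have hpos : 0 < β ^ n := by positivity
  have h1 : ∫⁻ x, f (remainder β a n x) =
      ∫⁻ x, (fun y => f (y + remainder β a n 0)) (β ^ n * x) := by
    refine lintegral_congr fun x => ?_
    rw [remainder_eq]
  rw [h1, ← lintegral_map (f := fun y => f (y + remainder β a n 0)) (by fun_prop) (by fun_prop),
    Real.map_volume_mul_left hpos.ne', lintegral_smul_measure, lintegral_add_right_eq_self f,
    abs_of_pos (by positivity), smul_eq_mul, ← ENNReal.ofReal_pow (by positivity), inv_pow]

/-! ### Hausdorff measure on digit sequences -/

/-- The ratio `β / 2 = 2 ^ (-s)`, `s = dimension β`, by which prepending a digit multiplies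
`s`-dimensional Hausdorff measure. -/
noncomputable def ratio (β : ℝ) : ℝ≥0∞ := ENNReal.ofReal (β / 2)

lemma ratio_ne_zero {β : ℝ} (hβ : 0 < β) : ratio β ≠ 0 := by
  simp [ratio, hβ]

lemma dimension_pos {β : ℝ} (h1 : 1 < β) (h2 : β < 2) : 0 < dimension β :=
  div_pos (Real.log_pos (by rw [lt_div_iff₀] <;> linarith)) (Real.log_pos one_lt_two)

lemma two_inv_rpow_dimension {β : ℝ} (hβ : 0 < β) :
    (2⁻¹ : ℝ≥0∞) ^ dimension β = ratio β := by
  have h2 : (2⁻¹ : ℝ≥0∞) = ENNReal.ofReal (2⁻¹ : ℝ) := by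
    rw [ENNReal.ofReal_inv_of_pos two_pos]; simp
  have hlog : Real.log 2 ≠ 0 := (Real.log_pos one_lt_two).ne'
  rw [h2, ENNReal.ofReal_rpow_of_pos (by norm_num), ratio, Real.rpow_def_of_pos (by norm_num),
    dimension, Real.log_inv, neg_mul, mul_div_cancel₀ _ hlog, ← Real.log_inv,
    Real.exp_log (by positivity), inv_div]

lemma two_inv_pow_rpow_dimension {β : ℝ} (hβ : 0 < β) (n : ℕ) :
    ((2⁻¹ : ℝ≥0∞) ^ n) ^ dimension β = ratio β ^ n := by
  rw [← two_inv_rpow_dimension hβ, ← ENNReal.rpow_natCast, ← ENNReal.rpow_natCast,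
    ← ENNReal.rpow_mul, ← ENNReal.rpow_mul, mul_comm]

section Metric

attribute [local instance] PiNat.metricSpace

lemma edist_eq_of_ne {a b : Seq} (h : a ≠ b) : edist a b = 2⁻¹ ^ firstDiff a b := by
  rw [edist_dist, dist_eq_of_ne h, ENNReal.ofReal_pow (by norm_num), one_div,
    ENNReal.ofReal_inv_of_pos two_pos]
  simp

lemma firstDiff_cons (d : Fin 2) {a b : Seq} (h : a ≠ b) :
    firstDiff (cons d a) (cons d b) = firstDiff a b + 1 := by
  have h' : cons d a ≠ cons d b := (cons_injective d).ne h
  refine le_antisymm ?_ ?_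
  · by_contra! hlt
    exact apply_firstDiff_ne h (by simpa using apply_eq_of_lt_firstDiff hlt)
  · refine (mem_cylinder_iff_le_firstDiff h' _).1 (mem_cylinder_iff.2 fun i hi => ?_)
    cases i with
    | zero => rfl
    | succ i => exact apply_eq_of_lt_firstDiff (x := a) (y := b) (Nat.lt_of_succ_lt_succ hi)

lemma edist_cons (d : Fin 2) (a b : Seq) : edist (cons d a) (cons d b) = 2⁻¹ * edist a b := by
  rcases eq_or_ne a b with rfl | h
  · simp
  · rw [edist_eq_of_ne h, edist_eq_of_ne ((cons_injective d).ne h), firstDiff_cons d h, pow_succ']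

lemma hausdorff_image_cons {β : ℝ} (h1 : 1 < β) (h2 : β < 2) (d : Fin 2) (A : Set Seq) :
    hausdorff (dimension β) (cons d '' A) = ratio β * hausdorff (dimension β) A := by
  have hs := (dimension_pos h1 h2).le
  have hβ : 0 < β := by linarith
  refine le_antisymm ?_ ?_
  · have hl : LipschitzWith 2⁻¹ (cons d) := fun a b => by
      rw [edist_cons, ENNReal.coe_inv two_ne_zero]; simp
    have := hl.hausdorffMeasure_image_le hs A
    rwa [ENNReal.coe_inv two_ne_zero, ENNReal.coe_ofNat, two_inv_rpow_dimension hβ] at this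
  · have hl : AntilipschitzWith 2 (cons d) := fun a b => by
      rw [edist_cons, ← mul_assoc, ENNReal.coe_ofNat,
        ENNReal.mul_inv_cancel two_ne_zero (by simp), one_mul]
    have := hl.le_hausdorffMeasure_image hs A
    calc ratio β * hausdorff (dimension β) A
        ≤ ratio β * ((2 : ℝ≥0) ^ dimension β * hausdorff (dimension β) (cons d '' A)) := by
          gcongr; exact this
      _ = hausdorff (dimension β) (cons d '' A) := by
          rw [← mul_assoc, ← two_inv_rpow_dimension hβ, ENNReal.inv_rpow, ENNReal.coe_ofNat,
            ENNReal.inv_mul_cancel, one_mul]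
          · simp [ENNReal.rpow_eq_zero_iff]
          · simp [ENNReal.rpow_eq_top_iff]

lemma ediam_cylinder_le (a : Seq) (n : ℕ) : Metric.ediam (PiNat.cylinder a n) ≤ 2⁻¹ ^ n := by
  refine Metric.ediam_le fun x hx y hy => ?_
  rcases eq_or_ne x y with rfl | hne
  · simp
  · rw [edist_eq_of_ne hne]
    refine pow_le_pow_right_of_le_one' (by simp) ((mem_cylinder_iff_le_firstDiff hne n).1 ?_)
    rw [mem_cylinder_iff_eq] at hx hy ⊢
    rw [hx, hy]

/-- A set of sequences is contained in a cylinder that is no larger, up to an error `ε` which is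
needed only for one-point sets. -/
lemma exists_cylinder_superset {s : ℝ} (hs : 0 < s) {t : Set Seq} (ht : t.Nonempty) {r ε : ℝ≥0∞}
    (hr : 0 < r) (htr : Metric.ediam t ≤ r) (hε : 0 < ε) :
    ∃ (a : Seq) (n : ℕ), t ⊆ PiNat.cylinder a n ∧ (2⁻¹ : ℝ≥0∞) ^ n ≤ r ∧
      ((2⁻¹ : ℝ≥0∞) ^ n) ^ s ≤ Metric.ediam t ^ s + ε := by
  classical
  rcases t.subsingleton_or_nontrivial with hsub | ⟨x, hx, y, hy, hxy⟩
  · obtain ⟨a, ha⟩ := ht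
    have h0 : Tendsto (fun n : ℕ => (2⁻¹ : ℝ≥0∞) ^ n) atTop (𝓝 0) :=
      ENNReal.tendsto_pow_atTop_nhds_zero_of_lt_one (by simp)
    have h1 : Tendsto (fun n : ℕ => ((2⁻¹ : ℝ≥0∞) ^ n) ^ s) atTop (𝓝 0) := by
      have := ((ENNReal.continuous_rpow_const (y := s)).tendsto 0).comp h0
      rwa [ENNReal.zero_rpow_of_pos hs] at this
    obtain ⟨n, hn, hn'⟩ := ((h0.eventually_lt_const hr).and (h1.eventually_lt_const hε)).exists
    exact ⟨a, n, fun b hb => hsub ha hb ▸ self_mem_cylinder a n, hn.le, hn'.le.trans le_add_self⟩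
  · have hex : ∃ n, ∃ a ∈ t, ∃ b ∈ t, a ≠ b ∧ firstDiff a b = n :=
      ⟨_, x, hx, y, hy, hxy, rfl⟩
    obtain ⟨a, ha, b, hb, hab, hn⟩ := Nat.find_spec hex
    have hle : (2⁻¹ : ℝ≥0∞) ^ Nat.find hex ≤ Metric.ediam t := by
      rw [← hn, ← edist_eq_of_ne hab]
      exact Metric.edist_le_ediam_of_mem ha hb
    refine ⟨a, Nat.find hex, fun c hc => ?_, hle.trans htr, ?_⟩
    · rcases eq_or_ne c a with rfl | hca
      · exact self_mem_cylinder _ _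
      · exact (mem_cylinder_iff_le_firstDiff hca _).2
          (Nat.find_min' hex ⟨c, hc, a, ha, hca, rfl⟩)
    · exact (ENNReal.rpow_le_rpow hle hs.le).trans le_self_add

/-- Mass distribution principle. -/
lemma le_hausdorff_of_cylinder_le {β : ℝ} (h1 : 1 < β) (h2 : β < 2) {η : Measure Seq} {C : ℝ≥0∞}
    (hC0 : C ≠ 0) (hC : C ≠ ∞) (h : ∀ a n, η (PiNat.cylinder a n) ≤ C * ratio β ^ n) :
    η ≤ C • hausdorff (dimension β) := by
  have hs := dimension_pos h1 h2
  have key : η ≤ Measure.mkMetric fun r => C * r ^ dimension β := by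
    refine Measure.le_mkMetric _ _ 1 one_pos fun t ht => ?_
    rcases t.eq_empty_or_nonempty with rfl | hne
    · simp
    · have : ∀ ε : ℝ≥0, 0 < ε → η t ≤ C * (Metric.ediam t ^ dimension β + ε) := fun ε hε => by
        obtain ⟨a, n, hta, -, hn⟩ := exists_cylinder_superset hs hne one_pos ht
          (ENNReal.coe_pos.2 hε)
        calc η t ≤ C * ratio β ^ n := (measure_mono hta).trans (h a n)
          _ ≤ _ := by rw [← two_inv_pow_rpow_dimension (by linarith)]; gcongr
      have hlim : Tendsto (fun ε : ℝ≥0 => C * (Metric.ediam t ^ dimension β + (ε : ℝ≥0∞)))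
          (𝓝[>] 0) (𝓝 (C * (Metric.ediam t ^ dimension β + ((0 : ℝ≥0) : ℝ≥0∞)))) := by
        refine Tendsto.mono_left ?_ nhdsWithin_le_nhds
        refine ENNReal.Tendsto.const_mul ?_ (Or.inr hC)
        exact tendsto_const_nhds.add (ENNReal.tendsto_coe.2 tendsto_id)
      rw [ENNReal.coe_zero, add_zero] at hlim
      exact ge_of_tendsto hlim (eventually_mem_nhdsWithin.mono this)
  exact key.trans (Measure.mkMetric_mono_smul hC hC0 (Eventually.of_forall fun r => le_rfl))

/-- For each mesh `r` the infimum over covers by sets of diameter at most `r` is upper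
semicontinuous in `x`, because an open cover of a fibre also covers the nearby fibres. -/
lemma measurable_hausdorff_expansions {β : ℝ} (h1 : 1 < β) (h2 : β < 2) :
    Measurable fun x => hausdorff (dimension β) (expansions β x) := by
  have hs := dimension_pos h1 h2
  set s := dimension β
  let pre : ℝ≥0∞ → ℝ → ℝ≥0∞ := fun r x =>
    ⨅ (t : ℕ → Set Seq) (_ : expansions β x ⊆ ⋃ n, t n) (_ : ∀ n, Metric.ediam (t n) ≤ r),
      ∑' n, ⨆ _ : (t n).Nonempty, Metric.ediam (t n) ^ s
  have hpre : ∀ r, 0 < r → Measurable (pre r) := by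
    intro r hr
    refine UpperSemicontinuous.measurable (upperSemicontinuous_iff_isOpen_preimage.2 fun c => ?_)
    refine isOpen_iff_mem_nhds.2 fun x hx => ?_
    simp only [pre, Set.mem_preimage, Set.mem_Iio, iInf_lt_iff] at hx
    obtain ⟨t, hcov, hdiam, hlt⟩ := hx
    obtain ⟨ε, hε, hsum⟩ := ENNReal.exists_pos_sum_of_countable (tsub_pos_of_lt hlt).ne' ℕ
    have hU : ∀ n, ∃ U : Set Seq, t n ⊆ U ∧ IsOpen U ∧ Metric.ediam U ≤ r ∧
        (⨆ _ : U.Nonempty, Metric.ediam U ^ s) ≤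
          (⨆ _ : (t n).Nonempty, Metric.ediam (t n) ^ s) + ε n := by
      intro n
      rcases (t n).eq_empty_or_nonempty with he | hne
      · exact ⟨∅, he.le, isOpen_empty, by simp, by simp⟩
      · obtain ⟨a, k, hsub, hk, hk'⟩ := exists_cylinder_superset hs hne hr (hdiam n)
          (ENNReal.coe_pos.2 (hε n))
        refine ⟨_, hsub, isOpen_cylinder _ a k, (ediam_cylinder_le a k).trans hk, ?_⟩
        refine iSup_le fun _ => ?_
        simp only [hne, iSup_pos]
        exact (ENNReal.rpow_le_rpow (ediam_cylinder_le a k) hs.le).trans hk'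
    choose U htU hUo hUr hUs using hU
    have hclosed : IsClosed (value β '' (⋃ n, U n)ᶜ) :=
      ((isOpen_iUnion hUo).isClosed_compl.isCompact.image (continuous_value h1)).isClosed
    have hx' : x ∈ (value β '' (⋃ n, U n)ᶜ)ᶜ := by
      rintro ⟨a, ha, rfl⟩
      exact ha (Set.iUnion_mono htU (hcov rfl))
    refine mem_of_superset (hclosed.isOpen_compl.mem_nhds hx') fun y hy => ?_
    have hcov' : expansions β y ⊆ ⋃ n, U n := fun a ha => by
      by_contra hna
      exact hy ⟨a, hna, ha⟩
    calc pre r y ≤ ∑' n, ⨆ _ : (U n).Nonempty, Metric.ediam (U n) ^ s :=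
          iInf_le_of_le U (iInf_le_of_le hcov' (iInf_le_of_le hUr le_rfl))
      _ ≤ ∑' n, ((⨆ _ : (t n).Nonempty, Metric.ediam (t n) ^ s) + ε n) :=
          ENNReal.tsum_le_tsum hUs
      _ = (∑' n, ⨆ _ : (t n).Nonempty, Metric.ediam (t n) ^ s) + ∑' n, (ε n : ℝ≥0∞) :=
          ENNReal.tsum_add
      _ < c := lt_tsub_iff_left.1 hsum
  have hh : (fun x => hausdorff s (expansions β x)) = fun x => ⨆ k : ℕ, pre (2⁻¹ ^ k) x := by
    funext x
    have : hausdorff s (expansions β x) = ⨆ (r) (_ : 0 < r), pre r x :=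
      Measure.hausdorffMeasure_apply s (expansions β x)
    rw [this]
    refine le_antisymm (iSup₂_le fun r hr => ?_) (iSup_le fun k => ?_)
    · obtain ⟨k, hk⟩ := ((ENNReal.tendsto_pow_atTop_nhds_zero_of_lt_one
        (r := 2⁻¹) (by simp)).eventually_lt_const hr).exists
      refine le_iSup_of_le k (iInf_mono fun t => iInf_mono fun _ => ?_)
      exact iInf_mono' fun h => ⟨fun n => (h n).trans hk.le, le_rfl⟩
    · exact le_iSup₂_of_le _ (ENNReal.pow_pos (by simp) k) le_rfl
  rw [hh]
  exact Measurable.iSup fun k => hpre _ (ENNReal.pow_pos (by simp) k)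

lemma hausdorff_expansions_inter_cylinder {β : ℝ} (h1 : 1 < β) (h2 : β < 2) (x : ℝ) (a : Seq)
    (n : ℕ) : hausdorff (dimension β) (expansions β x ∩ PiNat.cylinder a n) =
      ratio β ^ n * hausdorff (dimension β) (expansions β (remainder β a n x)) := by
  induction n generalizing a x with
  | zero => simp [remainder, cylinder_zero]
  | succ n ih =>
    rw [expansions_inter_cylinder_succ h1, hausdorff_image_cons h1 h2, ih, remainder, pow_succ',
      mul_assoc]

lemma remainder_mem_interval {β : ℝ} (hβ : 1 < β) {x : ℝ} {a : Seq} {n : ℕ}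
    (h : (expansions β x ∩ PiNat.cylinder a n).Nonempty) : remainder β a n x ∈ interval β := by
  induction n generalizing a x with
  | zero =>
    obtain ⟨b, hb, -⟩ := h
    have hb : value β b = x := hb
    exact hb ▸ value_mem_interval hβ b
  | succ n ih =>
    rw [expansions_inter_cylinder_succ hβ, Set.image_nonempty] at h
    exact ih h

/-- Covering every fibre by cylinders of length `n` bounds the integral of its Hausdorff measure by
`2 ^ n * (β / 2) ^ n * (β⁻¹) ^ n` times the length of the interval of all values. -/
lemma lintegral_hausdorff_lt_top {β : ℝ} (h1 : 1 < β) (h2 : β < 2) :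
    ∫⁻ x, hausdorff (dimension β) (expansions β x) < ∞ := by
  have hs := dimension_pos h1 h2
  have hβ : 0 < β := by linarith
  set s := dimension β
  let word : ∀ n : ℕ, (Fin n → Fin 2) → Seq := fun n w i => if h : i < n then w ⟨i, h⟩ else 0
  let g : ℝ → ℝ≥0∞ := (interval β).indicator 1
  have hg : Measurable g := measurable_one.indicator measurableSet_Icc
  let G : ℕ → ℝ → ℝ≥0∞ := fun n x =>
    ∑ w : Fin n → Fin 2, ratio β ^ n * g (remainder β (word n w) n x)
  have hG : ∀ n, Measurable (G n) := fun n => Finset.measurable_sum _ fun w _ =>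
    (hg.comp (measurable_remainder β _ n)).const_mul _
  have hle : ∀ x, hausdorff s (expansions β x) ≤ liminf (fun n => G n x) atTop := by
    intro x
    refine (Measure.hausdorffMeasure_le_liminf_sum s (expansions β x) (fun n : ℕ => 2⁻¹ ^ n)
      (ENNReal.tendsto_pow_atTop_nhds_zero_of_lt_one (by simp))
      (fun n (w : Fin n → Fin 2) => expansions β x ∩ PiNat.cylinder (word n w) n)
      (Eventually.of_forall fun n w => (Metric.ediam_mono Set.inter_subset_right).trans
        (ediam_cylinder_le _ n))
      (Eventually.of_forall fun n a ha => ?_)).trans ?_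
    · refine Set.mem_iUnion.2 ⟨fun i => a i, ha, mem_cylinder_iff.2 fun i hi => ?_⟩
      simp [word, hi]
    · refine liminf_le_liminf (Eventually.of_forall fun n => Finset.sum_le_sum fun w _ => ?_)
      rcases (expansions β x ∩ PiNat.cylinder (word n w) n).eq_empty_or_nonempty with he | hne
      · rw [he]; simp [hs]
      · simp only [g, Set.indicator_of_mem (remainder_mem_interval h1 hne), Pi.one_apply, mul_one]
        rw [← two_inv_pow_rpow_dimension hβ]
        exact ENNReal.rpow_le_rpow ((Metric.ediam_mono Set.inter_subset_right).trans
          (ediam_cylinder_le _ n)) hs.le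
  have hint : ∀ n, ∫⁻ x, G n x = volume (interval β) := by
    intro n
    have hone : (2 : ℝ≥0∞) * (ratio β * ENNReal.ofReal β⁻¹) = 1 := by
      rw [ratio, ← ENNReal.ofReal_mul (by positivity), ← ENNReal.ofReal_ofNat,
        ← ENNReal.ofReal_mul (by positivity), ← ENNReal.ofReal_one]
      congr 1; field_simp
    have hm : ∀ w : Fin n → Fin 2, Measurable fun x => g (remainder β (word n w) n x) := fun w =>
      hg.comp (measurable_remainder β _ n)
    simp only [G]
    rw [lintegral_finsetSum _ fun w _ => (hm w).const_mul _]
    simp only [lintegral_const_mul _ (hm _), lintegral_remainder h1 _ n hg]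
    rw [Finset.sum_const, Finset.card_univ, Fintype.card_fun, Fintype.card_fin, Fintype.card_fin,
      nsmul_eq_mul, ← mul_assoc, ← mul_assoc, Nat.cast_pow, Nat.cast_ofNat, ← mul_pow, ← mul_pow,
      mul_assoc 2, hone, one_pow, one_mul]
    exact lintegral_indicator_one measurableSet_Icc
  calc ∫⁻ x, hausdorff s (expansions β x) ≤ ∫⁻ x, liminf (fun n => G n x) atTop :=
        lintegral_mono hle
    _ ≤ liminf (fun n => ∫⁻ x, G n x) atTop := lintegral_liminf_le hG
    _ = volume (interval β) := by simp [hint]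
    _ < ∞ := by simp [interval]

/-- Upper density bound: in a set `E` of finite Hausdorff measure, the points `a` for which
infinitely many of the cylinders `[a_1 ⋯ a_n]` meet `E` in measure at least twice the `s`-th power
of their diameter form a null set. -/
lemma hausdorff_eq_zero_of_frequently {β : ℝ} (h1 : 1 < β) (h2 : β < 2) {E A : Set Seq}
    (hE : MeasurableSet E) (hfin : hausdorff (dimension β) E ≠ ∞) (hAE : A ⊆ E)
    (hA : ∀ a ∈ A, ∃ᶠ n in atTop,
      2 * ratio β ^ n ≤ hausdorff (dimension β) (E ∩ PiNat.cylinder a n)) :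
    hausdorff (dimension β) A = 0 := by
  have hs := dimension_pos h1 h2
  have hβ : 0 < β := by linarith
  set s := dimension β
  set η : Measure Seq := (hausdorff s).restrict E with hη
  have hηfin : IsFiniteMeasure η := ⟨by rw [hη, Measure.restrict_apply_univ]; exact hfin.lt_top⟩
  have hηA : η A = hausdorff s A := by
    rw [hη, Measure.restrict_apply' hE, Set.inter_eq_left.2 hAE]
  have hηC : ∀ a n, η (PiNat.cylinder a n) = hausdorff s (E ∩ PiNat.cylinder a n) := fun a n => by
    rw [hη, Measure.restrict_apply' hE, Set.inter_comm]
  have key : ∀ U, A ⊆ U → IsOpen U → 2 * hausdorff s A ≤ η U := by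
    intro U hAU hU
    -- the maximal heavy cylinders of length at least `N` inside `U`
    let heavy : ℕ → Seq → ℕ → Prop := fun N a n =>
      N ≤ n ∧ PiNat.cylinder a n ⊆ U ∧ 2 * ratio β ^ n ≤ η (PiNat.cylinder a n)
    let F : ℕ → Set (Set Seq) := fun N =>
      {C | ∃ a n, C = PiNat.cylinder a n ∧ heavy N a n ∧ ∀ m < n, ¬ heavy N a m}
    have hheavy : ∀ {N a b n}, b ∈ PiNat.cylinder a n → (heavy N b n ↔ heavy N a n) := by
      intro N a b n hb
      simp only [heavy, mem_cylinder_iff_eq.1 hb]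
    have hFc : ∀ N, (F N).Countable := fun N => countable_cylinders.mono (by
      rintro _ ⟨a, n, rfl, -⟩
      exact Or.inr ⟨a, n, rfl⟩)
    have hFc' : ∀ N, Countable (F N) := fun N => (hFc N).to_subtype
    have hdisj : ∀ N, (F N).PairwiseDisjoint id := by
      rintro N _ ⟨a, n, rfl, ha, ha'⟩ _ ⟨b, m, rfl, hb, hb'⟩ hne
      refine Set.disjoint_left.2 fun c (hca : c ∈ PiNat.cylinder a n)
        (hcb : c ∈ PiNat.cylinder b m) => ?_
      rcases lt_trichotomy n m with hnm | rfl | hnm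
      · exact hb' n hnm ((hheavy (cylinder_anti b hnm.le hcb)).1 ((hheavy hca).2 ha))
      · exact hne ((mem_cylinder_iff_eq.1 hca).symm.trans (mem_cylinder_iff_eq.1 hcb))
      · exact ha' m hnm ((hheavy (cylinder_anti a hnm.le hca)).1 ((hheavy hcb).2 hb))
    have hsum : ∀ N, 2 * ∑' C : F N, Metric.ediam (C : Set Seq) ^ s ≤ η U := by
      intro N
      calc 2 * ∑' C : F N, Metric.ediam (C : Set Seq) ^ s
          = ∑' C : F N, 2 * Metric.ediam (C : Set Seq) ^ s := ENNReal.tsum_mul_left.symm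
        _ ≤ ∑' C : F N, η C := by
            refine ENNReal.tsum_le_tsum fun C => ?_
            obtain ⟨_, a, n, rfl, ha, -⟩ := C
            refine le_trans ?_ ha.2.2
            rw [← two_inv_pow_rpow_dimension hβ]
            gcongr
            exact ediam_cylinder_le a n
        _ = η (⋃ C ∈ F N, C) := by
            refine (measure_biUnion (hFc N) (hdisj N) ?_).symm
            rintro _ ⟨a, n, rfl, -⟩
            exact measurableSet_cylinder a n
        _ ≤ η U := by
            refine measure_mono (Set.iUnion₂_subset ?_)
            rintro _ ⟨a, n, rfl, ha, -⟩
            exact ha.2.1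
    have hle := Measure.hausdorffMeasure_le_liminf_tsum s A (fun n : ℕ => 2⁻¹ ^ n)
      (ENNReal.tendsto_pow_atTop_nhds_zero_of_lt_one (by simp))
      (fun N (C : F N) => (C : Set Seq))
      (Eventually.of_forall fun N C => by
        obtain ⟨_, a, n, rfl, ha, -⟩ := C
        exact (ediam_cylinder_le a n).trans (pow_le_pow_right_of_le_one' (by simp) ha.1))
      (Eventually.of_forall fun N a ha => by
        classical
        have hex : ∃ n, heavy N a n := by
          obtain ⟨_, ⟨b, k, rfl⟩, hab, hbU⟩ :=
            (isTopologicalBasis_cylinders fun _ : ℕ => Fin 2).exists_subset_of_mem_open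
              (hAU ha) hU
          obtain ⟨n, hn, hn1, hn2⟩ :=
            ((hA a ha).and_eventually ((eventually_ge_atTop N).and (eventually_ge_atTop k))).exists
          refine ⟨n, hn1, (cylinder_anti a hn2).trans ?_, by rwa [hηC]⟩
          rwa [mem_cylinder_iff_eq.1 hab]
        exact Set.mem_iUnion.2 ⟨⟨_, a, Nat.find hex, rfl, Nat.find_spec hex,
          fun m hm => Nat.find_min hex hm⟩, self_mem_cylinder a _⟩)
    have hlim : liminf (fun N => ∑' C : F N, Metric.ediam (C : Set Seq) ^ s) atTop ≤ 2⁻¹ * η U := by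
      refine (liminf_le_liminf (v := fun _ => 2⁻¹ * η U) (Eventually.of_forall fun N => ?_)).trans
        (by simp)
      rw [← ENNReal.div_eq_inv_mul, ENNReal.le_div_iff_mul_le (by simp) (by simp), mul_comm]
      exact hsum N
    calc 2 * hausdorff s A ≤ 2 * (2⁻¹ * η U) := by gcongr; exact hle.trans hlim
      _ = η U := by rw [← mul_assoc, ENNReal.mul_inv_cancel (by simp) (by simp), one_mul]
  by_contra h0
  have hAfin : hausdorff s A ≠ ∞ := ((measure_mono hAE).trans_lt hfin.lt_top).ne
  have hlt : η A < 2 * hausdorff s A := by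
    rw [hηA, two_mul]
    exact ENNReal.lt_add_right hAfin h0
  obtain ⟨U, hAU, hU, hUlt⟩ := A.exists_isOpen_lt_of_lt _ hlt
  exact (key U hAU hU).not_gt hUlt

end Metric

/-! ### Integrating Hausdorff measure over the fibres -/

/-- The `dimension β`-dimensional Hausdorff measure of the set of `β`-expansions of `x`. -/
noncomputable def fibreSize (β x : ℝ) : ℝ≥0∞ := hausdorff (dimension β) (expansions β x)

/-- The integral over all `x` of the Hausdorff measure of the set of `β`-expansions of `x`. -/
noncomputable def totalSize (β : ℝ) : ℝ≥0∞ := ∫⁻ x, fibreSize β x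

lemma measurable_fibreSize {β : ℝ} (h1 : 1 < β) (h2 : β < 2) : Measurable (fibreSize β) :=
  measurable_hausdorff_expansions h1 h2

lemma totalSize_ne_top {β : ℝ} (h1 : 1 < β) (h2 : β < 2) : totalSize β ≠ ∞ :=
  (lintegral_hausdorff_lt_top h1 h2).ne

lemma ae_fibreSize_lt_top {β : ℝ} (h1 : 1 < β) (h2 : β < 2) : ∀ᵐ x, fibreSize β x < ∞ :=
  ae_lt_top (measurable_fibreSize h1 h2) (totalSize_ne_top h1 h2)

lemma fibreSize_eq_zero {β x : ℝ} (h1 : 1 < β) (hx : x ∉ interval β) : fibreSize β x = 0 := by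
  rw [fibreSize, expansions_eq_empty h1 hx, measure_empty]

lemma normalisedHausdorff_apply {β : ℝ} (h1 : 1 < β) (x : ℝ) (A : Set Seq) :
    normalisedHausdorff β x A =
      (fibreSize β x)⁻¹ * hausdorff (dimension β) (A ∩ expansions β x) := by
  rw [normalisedHausdorff, Measure.smul_apply,
    Measure.restrict_apply' (measurableSet_expansions h1 x), smul_eq_mul, fibreSize]

lemma fibreSize_mul_normalisedHausdorff {β x : ℝ} (h1 : 1 < β) (hx : fibreSize β x ≠ ∞)
    (A : Set Seq) : fibreSize β x * normalisedHausdorff β x A =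
      hausdorff (dimension β) (A ∩ expansions β x) := by
  rw [normalisedHausdorff_apply h1, ← mul_assoc]
  rcases eq_or_ne (fibreSize β x) 0 with h0 | h0
  · rw [h0, zero_mul, zero_mul]
    exact (measure_mono_null Set.inter_subset_right h0).symm
  · rw [ENNReal.mul_inv_cancel h0 hx, one_mul]

lemma normalisedHausdorff_univ {β x : ℝ} (h1 : 1 < β) (h0 : fibreSize β x ≠ 0)
    (hx : fibreSize β x ≠ ∞) : normalisedHausdorff β x Set.univ = 1 := by
  rw [normalisedHausdorff_apply h1, Set.univ_inter]
  exact ENNReal.inv_mul_cancel h0 hx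

/-- If the fibre has infinite Hausdorff measure then its normalisation is the zero measure, by the
conventions `∞⁻¹ = 0` and `0 * ∞ = 0`; so the normalised measures are finite in all cases. -/
lemma isFiniteMeasure_normalisedHausdorff {β : ℝ} (h1 : 1 < β) (x : ℝ) :
    IsFiniteMeasure (normalisedHausdorff β x) := by
  refine ⟨lt_of_le_of_lt ?_ ENNReal.one_lt_top⟩
  rw [normalisedHausdorff_apply h1, Set.univ_inter]
  exact ENNReal.inv_mul_le_one (fibreSize β x)

lemma hausdorff_cylinder_inter_expansions {β : ℝ} (h1 : 1 < β) (h2 : β < 2) (x : ℝ) (a : Seq)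
    (n : ℕ) : hausdorff (dimension β) (PiNat.cylinder a n ∩ expansions β x) =
      ratio β ^ n * fibreSize β (remainder β a n x) := by
  rw [Set.inter_comm, hausdorff_expansions_inter_cylinder h1 h2, fibreSize]

lemma measurable_normalisedHausdorff {β : ℝ} (h1 : 1 < β) (h2 : β < 2) :
    Measurable (normalisedHausdorff β) := by
  have := isFiniteMeasure_normalisedHausdorff h1
  have hm := measurable_fibreSize h1 h2
  have hC : ∀ a n, Measurable fun x => normalisedHausdorff β x (PiNat.cylinder a n) := by
    intro a n
    simp only [normalisedHausdorff_apply h1, hausdorff_cylinder_inter_expansions h1 h2]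
    exact hm.inv.mul ((hm.comp (measurable_remainder β a n)).const_mul _)
  refine Measurable.measure_of_isPiSystem generateFrom_cylinders isPiSystem_cylinders ?_ ?_
  · rintro _ (rfl | ⟨a, n, rfl⟩)
    · simp
    · exact hC a n
  · simpa [cylinder_zero] using hC 0 0

/-- The normalised Hausdorff measures on the fibres, as a kernel. -/
noncomputable def normalisedKernel {β : ℝ} (h1 : 1 < β) (h2 : β < 2) : Kernel ℝ Seq :=
  ⟨normalisedHausdorff β, measurable_normalisedHausdorff h1 h2⟩

lemma withDensity_bind_normalisedHausdorff_apply {β : ℝ} (h1 : 1 < β) (h2 : β < 2) {A : Set Seq}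
    (hA : MeasurableSet A) :
    (volume.withDensity (fibreSize β)).bind (normalisedHausdorff β) A =
      ∫⁻ x, hausdorff (dimension β) (A ∩ expansions β x) := by
  have hN := measurable_normalisedHausdorff h1 h2
  have hNA : Measurable fun x => normalisedHausdorff β x A := (Measure.measurable_coe hA).comp hN
  rw [Measure.bind_apply hA hN.aemeasurable,
    lintegral_withDensity_eq_lintegral_mul _ (measurable_fibreSize h1 h2) hNA]
  refine lintegral_congr_ae ?_
  filter_upwards [ae_fibreSize_lt_top h1 h2] with x hx
  rw [Pi.mul_apply, fibreSize_mul_normalisedHausdorff h1 hx.ne]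

/-- Integrating the Hausdorff measures on the fibres over `x` gives a multiple of the Bernoulli
measure: by self-similarity a cylinder of length `n` receives the share
`(β / 2) ^ n * (β⁻¹) ^ n = (1 / 2) ^ n` of the total. -/
lemma withDensity_bind_normalisedHausdorff {β : ℝ} (h1 : 1 < β) (h2 : β < 2) :
    (volume.withDensity (fibreSize β)).bind (normalisedHausdorff β) =
      totalSize β • uniformBernoulli := by
  have hm := measurable_fibreSize h1 h2
  have : IsFiniteMeasure (totalSize β • uniformBernoulli) :=
    Measure.smul_finite _ (totalSize_ne_top h1 h2)
  refine (measure_ext_cylinder fun a n => ?_).symm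
  have hhalf : ratio β * ENNReal.ofReal β⁻¹ = 2⁻¹ := by
    rw [ratio, ← ENNReal.ofReal_mul (by positivity),
      show (2⁻¹ : ℝ≥0∞) = ENNReal.ofReal (2⁻¹ : ℝ) by
        rw [ENNReal.ofReal_inv_of_pos two_pos]; simp]
    congr 1
    have : β ≠ 0 := by linarith
    field_simp
  rw [withDensity_bind_normalisedHausdorff_apply h1 h2 (measurableSet_cylinder a n)]
  have hmr : Measurable fun x => fibreSize β (remainder β a n x) :=
    hm.comp (measurable_remainder β a n)
  simp only [hausdorff_cylinder_inter_expansions h1 h2]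
  rw [lintegral_const_mul _ hmr, lintegral_remainder h1 a n hm,
    ← mul_assoc, ← mul_pow, hhalf, Measure.smul_apply, uniformBernoulli_cylinder, smul_eq_mul,
    mul_comm, totalSize]

lemma totalSize_mul_uniformBernoulli {β : ℝ} (h1 : 1 < β) (h2 : β < 2) {A : Set Seq}
    (hA : MeasurableSet A) : totalSize β * uniformBernoulli A =
      ∫⁻ x, hausdorff (dimension β) (A ∩ expansions β x) := by
  rw [← withDensity_bind_normalisedHausdorff_apply h1 h2 hA,
    withDensity_bind_normalisedHausdorff h1 h2, Measure.smul_apply, smul_eq_mul]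

lemma isProbabilityMeasure_convolution {β : ℝ} (h1 : 1 < β) :
    IsProbabilityMeasure (convolution β) :=
  Measure.isProbabilityMeasure_map (measurable_value h1).aemeasurable

/-- Up to the factor `totalSize β`, the Hausdorff measure of the fibres is the density of the
Bernoulli convolution. -/
lemma totalSize_smul_convolution {β : ℝ} (h1 : 1 < β) (h2 : β < 2) :
    totalSize β • convolution β = volume.withDensity (fibreSize β) := by
  refine Measure.ext fun B hB => ?_
  rw [Measure.smul_apply, convolution, Measure.map_apply (measurable_value h1) hB, smul_eq_mul,
    totalSize_mul_uniformBernoulli h1 h2 (measurable_value h1 hB), withDensity_apply _ hB,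
    ← lintegral_indicator hB]
  refine lintegral_congr fun x => ?_
  by_cases hx : x ∈ B
  · rw [Set.indicator_of_mem hx, fibreSize]
    congr 1
    refine Set.inter_eq_right.2 fun a ha => ?_
    have ha : value β a = x := ha
    simpa [ha] using hx
  · rw [Set.indicator_of_notMem hx]
    convert measure_empty (μ := hausdorff (dimension β))
    refine Set.eq_empty_of_forall_notMem fun a ⟨haB, ha⟩ => hx ?_
    have ha : value β a = x := ha
    simpa [ha] using haB

/-! ### Boundedness of the density -/

/-- If `fibreSize` were `≥ 2` with positive probability, then by Poincaré recurrence it would be so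
along the orbit of almost every point of this set infinitely often, against the upper density
bound. -/
lemma ae_fibreSize_lt_two {β : ℝ} (h1 : 1 < β) (h2 : β < 2) : ∀ᵐ x, fibreSize β x < 2 := by
  rcases eq_or_ne (totalSize β) 0 with hc | hc
  · have : fibreSize β =ᵐ[volume] 0 := (lintegral_eq_zero_iff (measurable_fibreSize h1 h2)).1 hc
    filter_upwards [this] with x hx
    rw [hx]; simp
  have hm := measurable_fibreSize h1 h2
  set B : Set ℝ := {x | 2 ≤ fibreSize β x} with hB
  have hBm : MeasurableSet B := measurableSet_le measurable_const hm
  set A : Set Seq := limsup (fun n => shift^[n] ⁻¹' (value β ⁻¹' B)) atTop with hA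
  have hAm : MeasurableSet A := MeasurableSet.measurableSet_limsup fun n =>
    measurable_shift.iterate n (measurable_value h1 hBm)
  have hAiff : ∀ a, a ∈ A ↔ ∃ᶠ n in atTop, value β (shift^[n] a) ∈ B := fun a => by
    rw [hA, mem_limsup_iff_frequently_mem]; rfl
  have hA0 : uniformBernoulli A = 0 := by
    have : totalSize β * uniformBernoulli A = 0 := by
      rw [totalSize_mul_uniformBernoulli h1 h2 hAm]
      refine (lintegral_congr_ae ?_).trans lintegral_zero
      filter_upwards [ae_fibreSize_lt_top h1 h2] with x hx
      refine hausdorff_eq_zero_of_frequently h1 h2 (measurableSet_expansions h1 x) hx.ne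
        Set.inter_subset_right fun a ⟨ha, hax⟩ => ((hAiff a).1 ha).mono fun n hn => ?_
      have hax : value β a = x := hax
      rw [hausdorff_expansions_inter_cylinder h1 h2, ← hax, remainder_value h1, mul_comm]
      gcongr
      exact hn
    exact (mul_eq_zero.1 this).resolve_left hc
  have hB0 : uniformBernoulli (value β ⁻¹' B) = 0 := by
    have hrec := measurePreserving_shift.conservative.ae_mem_imp_frequently_image_mem
      (measurable_value h1 hBm).nullMeasurableSet
    refine measure_mono_null_ae ?_ hA0
    filter_upwards [hrec] with a ha ha'
    exact (hAiff a).2 (ha ha')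
  have hB1 : volume.withDensity (fibreSize β) B = 0 := by
    rw [← totalSize_smul_convolution h1 h2, Measure.smul_apply, convolution,
      Measure.map_apply (measurable_value h1) hBm, hB0, smul_zero]
  rw [withDensity_apply_eq_zero hm] at hB1
  have hsub : B ⊆ {x | fibreSize β x ≠ 0} ∩ B := fun x hx =>
    ⟨(zero_lt_two.trans_le (show 2 ≤ fibreSize β x from hx)).ne', hx⟩
  have hvol : volume B = 0 := measure_mono_null hsub hB1
  filter_upwards [compl_mem_ae_iff.2 hvol] with x hx
  exact not_le.1 hx

lemma convolution_eq_withDensity {β : ℝ} (h1 : 1 < β) (h2 : β < 2) (hc : totalSize β ≠ 0) :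
    convolution β = volume.withDensity ((totalSize β)⁻¹ • fibreSize β) := by
  rw [withDensity_smul _ (measurable_fibreSize h1 h2), ← totalSize_smul_convolution h1 h2,
    smul_smul, ENNReal.inv_mul_cancel hc (totalSize_ne_top h1 h2), one_smul]

lemma hasBoundedDensity_of_totalSize_ne_zero {β : ℝ} (h1 : 1 < β) (h2 : β < 2)
    (hc : totalSize β ≠ 0) : HasBoundedDensity β := by
  have hm := measurable_fibreSize h1 h2
  have hν := convolution_eq_withDensity h1 h2 hc
  refine ⟨hν ▸ withDensity_absolutelyContinuous _ _, ((totalSize β)⁻¹ * 2).toNNReal,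
    ae_restrict_of_ae ?_⟩
  have hfin : (totalSize β)⁻¹ * 2 ≠ ∞ := ENNReal.mul_ne_top (ENNReal.inv_ne_top.2 hc) (by simp)
  rw [hν, ENNReal.coe_toNNReal hfin]
  filter_upwards [Measure.rnDeriv_withDensity volume (hm.const_smul (totalSize β)⁻¹),
    ae_fibreSize_lt_two h1 h2] with x hx hx2
  rw [hx, Pi.smul_apply, smul_eq_mul]
  gcongr

/-! ### Positivity of the density -/

lemma exists_remainder_mem_interval {β : ℝ} (h1 : 1 < β) (h2 : β < 2) (n : ℕ) {x : ℝ}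
    (hx : x ∈ interval β) : ∃ a, remainder β a n x ∈ interval β := by
  induction n generalizing x with
  | zero => exact ⟨0, hx⟩
  | succ n ih =>
    have hd : ∃ d : Fin 2, β * x - (d : ℕ) ∈ interval β := by
      have hβ1 : 0 < β - 1 := by linarith
      obtain ⟨hx0, hx1⟩ := hx
      rw [le_div_iff₀ hβ1] at hx1
      by_cases hlt : β * x < 1
      · refine ⟨0, ?_, ?_⟩
        · simp; positivity
        · rw [le_div_iff₀ hβ1]; simp; nlinarith
      · refine ⟨1, ?_, ?_⟩
        · simp; linarith
        · rw [le_div_iff₀ hβ1]; simp; nlinarith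
    obtain ⟨d, hd⟩ := hd
    obtain ⟨a, ha⟩ := ih hd
    exact ⟨cons d a, ha⟩

lemma fibreSize_remainder_eq_zero {β x : ℝ} (h1 : 1 < β) (h2 : β < 2) (hx : fibreSize β x = 0)
    (a : Seq) (n : ℕ) : fibreSize β (remainder β a n x) = 0 := by
  have h : ratio β ^ n * fibreSize β (remainder β a n x) = 0 := by
    rw [← hausdorff_cylinder_inter_expansions h1 h2]
    exact measure_mono_null Set.inter_subset_right hx
  exact (mul_eq_zero.1 h).resolve_left (pow_ne_zero _ (ratio_ne_zero (by linarith)))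

/-- The zero set of `fibreSize` is invariant under the expanding remainder maps. Blowing it up
around one of its density points shows that it is null or of full measure. -/
lemma ae_fibreSize_pos {β : ℝ} (h1 : 1 < β) (h2 : β < 2) (hc : totalSize β ≠ 0) :
    ∀ᵐ x ∂volume.restrict (interval β), 0 < fibreSize β x := by
  have hm := measurable_fibreSize h1 h2
  have hI : MeasurableSet (interval β) := measurableSet_Icc
  set Z : Set ℝ := interval β ∩ {x | fibreSize β x = 0} with hZ
  have hZm : MeasurableSet Z := hI.inter (hm (measurableSet_singleton 0))
  set R : ℝ := 1 / (β - 1) with hR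
  have hR0 : 0 < R := by rw [hR]; apply one_div_pos.2; linarith
  have hvolI : volume (interval β) = ENNReal.ofReal R := by simp [interval, hR]
  have hZ0 : volume Z = 0 := by
    by_contra hZ0
    have : NeBot (ae (volume.restrict Z)) := by
      rw [ae_neBot]; rwa [Ne, Measure.restrict_eq_zero]
    obtain ⟨x, hdens, hxZ⟩ := ((IsUnifLocDoublingMeasure.ae_tendsto_measure_inter_div
      (volume : Measure ℝ) Z 1).and (ae_restrict_mem hZm)).exists
    choose a ha using fun n => exists_remainder_mem_interval h1 h2 n hxZ.1
    -- the preimage of `interval β` under the remainder map of `a n` is a ball of radius `δ n`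
    set δ : ℕ → ℝ := fun n => β⁻¹ ^ n * (R / 2) with hδ
    set w : ℕ → ℝ := fun n => β⁻¹ ^ n * (R / 2 - remainder β (a n) n 0) with hw
    have hpos : ∀ n, 0 < β⁻¹ ^ n := fun n => by positivity
    have hball : ∀ n y, y ∈ Metric.closedBall (w n) (δ n) ↔ remainder β (a n) n y ∈ interval β := by
      intro n y
      have hy : y - w n = β⁻¹ ^ n * (remainder β (a n) n y - R / 2) := by
        rw [remainder_eq β (a n) n y]
        simp only [hw, inv_pow]
        have : β ^ n ≠ 0 := by positivity
        field_simp; ring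
      rw [Metric.mem_closedBall, Real.dist_eq, hy, abs_mul, abs_of_pos (hpos n), hδ,
        mul_le_mul_iff_right₀ (hpos n), abs_le, interval, Set.mem_Icc, ← hR]
      constructor <;> rintro ⟨h, h'⟩ <;> constructor <;> linarith
    have hδ0 : Tendsto δ atTop (𝓝[>] 0) := by
      refine tendsto_nhdsWithin_iff.2 ⟨?_, Eventually.of_forall fun n =>
        mul_pos (hpos n) (half_pos hR0)⟩
      simpa only [zero_mul] using (tendsto_pow_atTop_nhds_zero_of_lt_one (r := β⁻¹) (by positivity)
        (inv_lt_one_of_one_lt₀ h1)).mul_const (R / 2)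
    have hlim := hdens w δ hδ0 (Eventually.of_forall fun n => by
      rw [one_mul, hball]; exact ha n)
    have hle : ∀ n, volume (Z ∩ Metric.closedBall (w n) (δ n)) /
        volume (Metric.closedBall (w n) (δ n)) ≤ volume Z / ENNReal.ofReal R := by
      intro n
      have hsub : Z ∩ Metric.closedBall (w n) (δ n) ⊆ remainder β (a n) n ⁻¹' Z := fun y hy =>
        ⟨(hball n y).1 hy.2, fibreSize_remainder_eq_zero h1 h2 hy.1.2 _ _⟩
      have hpre : volume (remainder β (a n) n ⁻¹' Z) = ENNReal.ofReal β⁻¹ ^ n * volume Z := by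
        rw [← lintegral_indicator_one hZm, ← lintegral_remainder h1 (a n) n
          (measurable_one.indicator hZm), ← lintegral_indicator_one
          (measurable_remainder β (a n) n hZm)]
        rfl
      have hvol : volume (Metric.closedBall (w n) (δ n)) =
          ENNReal.ofReal β⁻¹ ^ n * ENNReal.ofReal R := by
        rw [Real.volume_closedBall, ← ENNReal.ofReal_pow (by positivity),
          ← ENNReal.ofReal_mul (hpos n).le, hδ]
        congr 1; ring
      rw [hvol]
      refine (ENNReal.div_le_div_right ((measure_mono hsub).trans_eq hpre) _).trans_eq ?_
      rw [ENNReal.mul_div_mul_left _ _ (pow_ne_zero _ ?_) (by simp)]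
      simp; linarith
    have hone : 1 ≤ volume Z / ENNReal.ofReal R := le_of_tendsto' hlim hle
    rw [ENNReal.le_div_iff_mul_le (by simp [hR0]) (by simp), one_mul, ← hvolI] at hone
    have hfull : volume (interval β \ Z) = 0 := by
      rw [measure_sdiff Set.inter_subset_left hZm.nullMeasurableSet
        ((measure_mono Set.inter_subset_left).trans_lt
          (hvolI ▸ ENNReal.ofReal_lt_top : volume (interval β) < ∞)).ne]
      exact tsub_eq_zero_of_le hone
    refine hc ((lintegral_eq_zero_iff hm).2 ?_)
    filter_upwards [compl_mem_ae_iff.2 hfull] with x hx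
    by_cases hxI : x ∈ interval β
    · by_contra hne
      exact hx ⟨hxI, fun hxZ => hne hxZ.2⟩
    · exact fibreSize_eq_zero h1 hxI
  rw [ae_restrict_iff' hI]
  filter_upwards [compl_mem_ae_iff.2 hZ0] with x hx hxI
  exact pos_iff_ne_zero.2 fun h => hx ⟨hxI, h⟩

/-! ### Bounded density forces fibres of positive size -/

lemma ae_mem_interval_convolution {β : ℝ} (h1 : 1 < β) :
    ∀ᵐ x ∂convolution β, x ∈ interval β := by
  have hI : MeasurableSet {x | x ∈ interval β} := measurableSet_Icc
  rw [convolution, ae_map_iff (measurable_value h1).aemeasurable hI]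
  exact Eventually.of_forall fun a => value_mem_interval h1 a

lemma HasBoundedDensity.exists_convolution_le {β : ℝ} (h1 : 1 < β) (h : HasBoundedDensity β) :
    ∃ C : ℝ≥0∞, C ≠ 0 ∧ C ≠ ∞ ∧ ∀ B, MeasurableSet B → convolution β B ≤ C * volume B := by
  obtain ⟨hac, c, hc⟩ := h
  have := isProbabilityMeasure_convolution h1
  have hI : MeasurableSet (interval β) := measurableSet_Icc
  refine ⟨c + 1, by simp, by simp, fun B hB => ?_⟩
  calc convolution β B = convolution β (B ∩ interval β) := by
        refine measure_congr ?_
        filter_upwards [ae_mem_interval_convolution h1] with x hx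
        exact propext ⟨fun h => ⟨h, hx⟩, fun h => h.1⟩
    _ = ∫⁻ x in B ∩ interval β, (convolution β).rnDeriv volume x :=
        (Measure.setLIntegral_rnDeriv hac _).symm
    _ ≤ ∫⁻ _ in B ∩ interval β, (c : ℝ≥0∞) :=
        lintegral_mono_ae (ae_mono (Measure.restrict_mono Set.inter_subset_right le_rfl) hc)
    _ = c * volume (B ∩ interval β) := setLIntegral_const _ _
    _ ≤ (c + 1) * volume B := by
        gcongr
        · exact le_self_add
        · exact Set.inter_subset_left

/-- By self-similarity, a bound on the density of the Bernoulli convolution bounds the joint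
distribution of the first `n` digits and the value. -/
lemma uniformBernoulli_cylinder_inter_le {β : ℝ} (h1 : 1 < β) {C : ℝ≥0∞}
    (hC : ∀ B, MeasurableSet B → convolution β B ≤ C * volume B) (a : Seq) (n : ℕ) {B : Set ℝ}
    (hB : MeasurableSet B) :
    uniformBernoulli (PiNat.cylinder a n ∩ value β ⁻¹' B) ≤ C * ratio β ^ n * volume B := by
  induction n generalizing a B with
  | zero =>
    have := hC B hB
    rw [convolution, Measure.map_apply (measurable_value h1) hB] at this
    simpa [cylinder_zero] using this
  | succ n ih =>
    have hβ : 0 < β := by linarith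
    set B' : Set ℝ := (fun y => β⁻¹ * (y + (a 0 : ℕ))) ⁻¹' B with hB'
    have hB'm : MeasurableSet B' := by
      have : Measurable fun y : ℝ => β⁻¹ * (y + (a 0 : ℕ)) := by fun_prop
      exact this hB
    have hpre : ∀ d : Fin 2, cons d ⁻¹' (PiNat.cylinder a (n + 1) ∩ value β ⁻¹' B) =
        if d = a 0 then PiNat.cylinder (shift a) n ∩ value β ⁻¹' B' else ∅ := by
      intro d
      rw [Set.preimage_inter, preimage_cons_cylinder]
      split_ifs with hd
      · congr 1
        ext b
        simp only [Set.mem_preimage, value_cons h1, hB', hd]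
        rw [mul_comm, add_comm]
      · simp
    have hvol : volume B' = ENNReal.ofReal β * volume B := by
      have h2 : B' = (fun y => y + ((a 0 : ℕ) : ℝ)) ⁻¹' ((fun y => β⁻¹ * y) ⁻¹' B) := rfl
      rw [h2, measure_preimage_add_right, Real.volume_preimage_mul_left (by positivity), inv_inv,
        abs_of_pos hβ]
    rw [uniformBernoulli_apply
      ((measurableSet_cylinder _ _).inter (measurable_value h1 hB))]
    simp only [hpre, apply_ite (uniformBernoulli), measure_empty, Finset.sum_ite_eq',
      Finset.mem_univ, if_true]
    refine (mul_le_mul_right (ih (shift a) hB'm) 2⁻¹).trans_eq ?_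
    have hr : ratio β = 2⁻¹ * ENNReal.ofReal β := by
      rw [ratio, div_eq_inv_mul, ENNReal.ofReal_mul (by norm_num),
        ENNReal.ofReal_inv_of_pos two_pos]
      simp
    rw [hvol, pow_succ, hr]
    ring

/-- With `p` the density of the Bernoulli convolution and `κ` the conditional distribution of the
digits given the value, the measure `p x • κ x` satisfies the hypothesis of the mass distribution
principle for almost every `x`. -/
lemma totalSize_ne_zero_of_hasBoundedDensity {β : ℝ} (h1 : 1 < β) (h2 : β < 2)
    (h : HasBoundedDensity β) : totalSize β ≠ 0 := by
  intro hc
  obtain ⟨C, hC0, hCtop, hC⟩ := h.exists_convolution_le h1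
  have hac := h.1
  have hprob := isProbabilityMeasure_convolution h1
  have hval := measurable_value h1
  have hpair : Measurable fun a : Seq => (value β a, a) := hval.prodMk measurable_id
  set p := (convolution β).rnDeriv volume with hp
  have hpm : Measurable p := Measure.measurable_rnDeriv _ _
  have hνp : volume.withDensity p = convolution β := Measure.withDensity_rnDeriv_eq _ _ hac
  let κ : Kernel ℝ Seq := condDistrib id (value β) uniformBernoulli
  have hκ : convolution β ⊗ₘ κ = uniformBernoulli.map fun a => (value β a, a) :=
    compProd_map_condDistrib aemeasurable_id
  have hbound : ∀ D ∈ cylinders, ∀ n, (∃ a, D = PiNat.cylinder a n) →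
      ∀ᵐ x, p x * κ x D ≤ C * ratio β ^ n := by
    rintro _ - n ⟨a, rfl⟩
    have hD := measurableSet_cylinder a n
    have hκm : Measurable fun x => κ x (PiNat.cylinder a n) := κ.measurable_coe hD
    refine ae_le_of_forall_setLIntegral_le_of_sigmaFinite (hpm.mul hκm) fun B hB _ => ?_
    calc ∫⁻ x in B, p x * κ x (PiNat.cylinder a n)
        = ∫⁻ x in B, κ x (PiNat.cylinder a n) ∂convolution β := by
          rw [← hνp, restrict_withDensity hB, lintegral_withDensity_eq_lintegral_mul _ hpm hκm]
          rfl
      _ = (convolution β ⊗ₘ κ) (B ×ˢ PiNat.cylinder a n) :=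
          (Measure.compProd_apply_prod hB hD).symm
      _ = uniformBernoulli (PiNat.cylinder a n ∩ value β ⁻¹' B) := by
          rw [hκ, Measure.map_apply hpair (hB.prod hD), Set.inter_comm]
          rfl
      _ ≤ C * ratio β ^ n * volume B := uniformBernoulli_cylinder_inter_le h1 hC a n hB
      _ = ∫⁻ _ in B, C * ratio β ^ n := (setLIntegral_const _ _).symm
  have hae : ∀ᵐ x, ∀ a n, p x * κ x (PiNat.cylinder a n) ≤ C * ratio β ^ n := by
    have : ∀ᵐ x, ∀ D ∈ cylinders, ∀ n, (∃ a, D = PiNat.cylinder a n) →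
        p x * κ x D ≤ C * ratio β ^ n :=
      (ae_ball_iff countable_cylinders).2 fun D hD => ae_all_iff.2 fun n =>
        eventually_imp_distrib_left.2 (hbound D hD n)
    filter_upwards [this] with x hx a n
    exact hx _ (Or.inr ⟨a, n, rfl⟩) n ⟨a, rfl⟩
  have hsupp : ∀ᵐ x ∂convolution β, ∀ᵐ a ∂κ x, a ∈ expansions β x := by
    refine Measure.ae_ae_of_ae_compProd (p := fun z => z.2 ∈ expansions β z.1) ?_
    have hmeas : MeasurableSet {z : ℝ × Seq | z.2 ∈ expansions β z.1} :=
      measurableSet_eq_fun (hval.comp measurable_snd) measurable_fst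
    rw [hκ, ae_map_iff hpair.aemeasurable hmeas]
    exact Eventually.of_forall fun a => rfl
  have hzero : ∀ᵐ x, fibreSize β x = 0 :=
    (lintegral_eq_zero_iff (measurable_fibreSize h1 h2)).1 hc
  have hppos : ∀ᵐ x ∂convolution β, 0 < p x := Measure.rnDeriv_pos hac
  have hae' := hac.ae_le hae
  have hzero' := hac.ae_le hzero
  obtain ⟨x, hx, hxE, hx0, hxp⟩ :=
    (Eventually.and hae' (hsupp.and (Eventually.and hzero' hppos))).exists
  have hle : p x • κ x ≤ C • hausdorff (dimension β) :=
    le_hausdorff_of_cylinder_le h1 h2 hC0 hCtop fun a n => hx a n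
  have h3 : p x * κ x (expansions β x) ≤ C * fibreSize β x := hle (expansions β x)
  rw [hx0, mul_zero, nonpos_iff_eq_zero, mul_eq_zero, or_iff_right hxp.ne'] at h3
  have h4 : κ x (expansions β x) = 1 :=
    (prob_compl_eq_zero_iff (measurableSet_expansions h1 x)).1 hxE
  exact one_ne_zero (h4.symm.trans h3)

/-! ### Disintegration -/

lemma uniformBernoulli_eq_bind {β : ℝ} (h1 : 1 < β) (h2 : β < 2) (hc : totalSize β ≠ 0) :
    (convolution β).bind (normalisedKernel h1 h2) = uniformBernoulli := by
  have h : totalSize β • (convolution β).bind (normalisedKernel h1 h2) =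
      totalSize β • uniformBernoulli := by
    rw [← withDensity_bind_normalisedHausdorff h1 h2, ← Measure.comp_smul,
      totalSize_smul_convolution h1 h2]
    rfl
  calc _ = (totalSize β)⁻¹ • totalSize β • (convolution β).bind (normalisedKernel h1 h2) := by
        rw [smul_smul, ENNReal.inv_mul_cancel hc (totalSize_ne_top h1 h2), one_smul]
    _ = _ := by
        rw [h, smul_smul, ENNReal.inv_mul_cancel hc (totalSize_ne_top h1 h2), one_smul]

lemma integrable_integral_and_integral_eq_of_bind_eq {X Y : Type*} [MeasurableSpace X]
    [MeasurableSpace Y] {μ : Measure Y} {ν : Measure X} {κ : Kernel X Y} (h : ν.bind κ = μ)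
    {f : Y → ℝ} (hf : Integrable f μ) :
    Integrable (fun x => ∫ y, f y ∂κ x) ν ∧ ∫ y, f y ∂μ = ∫ x, (∫ y, f y ∂κ x) ∂ν := by
  subst h
  rw [Measure.comp_eq_comp_const_apply] at hf ⊢
  have h1 := hf.integral_comp
  have h2 := Kernel.integral_comp hf
  rw [Kernel.const_apply] at h1 h2
  exact ⟨h1, h2⟩

lemma isDisintegration_normalisedHausdorff {β : ℝ} (h1 : 1 < β) (h2 : β < 2)
    (hb : HasBoundedDensity β) : IsDisintegration β (normalisedHausdorff β) := by
  have hc := totalSize_ne_zero_of_hasBoundedDensity h1 h2 hb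
  have hbind := uniformBernoulli_eq_bind h1 h2 hc
  have hI : MeasurableSet (interval β) := measurableSet_Icc
  refine ⟨?_, ?_, fun f hf => ?_, fun f hf => ?_, fun f hf => ?_⟩
  · have hpos := (ae_restrict_iff' hI).1 (ae_fibreSize_pos h1 h2 hc)
    filter_upwards [hb.1.ae_le hpos, hb.1.ae_le (ae_fibreSize_lt_top h1 h2),
      ae_mem_interval_convolution h1] with x hx hx' hxI
    exact ⟨normalisedHausdorff_univ h1 (hx hxI).ne' hx'.ne⟩
  · refine Eventually.of_forall fun x => ?_
    rw [normalisedHausdorff_apply h1, Set.compl_inter_self, measure_empty, mul_zero]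
  · exact Measure.ae_integrable_of_integrable_comp (κ := normalisedKernel h1 h2) (hbind.symm ▸ hf)
  · exact (integrable_integral_and_integral_eq_of_bind_eq hbind hf).1
  · exact (integrable_integral_and_integral_eq_of_bind_eq hbind hf).2

/-- The mass which a disintegration gives to a measurable set is, as a function on the base,
determined by its integrals over all measurable sets. -/
lemma IsDisintegration.setIntegral_eq {β : ℝ} (h1 : 1 < β) {M : ℝ → Measure Seq}
    (hM : IsDisintegration β M) {D : Set Seq} (hD : MeasurableSet D) {B : Set ℝ}
    (hB : MeasurableSet B) :
    ∫ x in B, (M x).real D ∂convolution β = uniformBernoulli.real (D ∩ value β ⁻¹' B) := by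
  have hDB : MeasurableSet (D ∩ value β ⁻¹' B) := hD.inter (measurable_value h1 hB)
  have h := hM.integral_eq ((D ∩ value β ⁻¹' B).indicator 1)
    ((integrable_const (1 : ℝ)).indicator hDB)
  simp only [integral_indicator_one hDB] at h
  rw [h, ← integral_indicator hB]
  refine integral_congr_ae ?_
  filter_upwards [hM.supported] with x hx
  have hxE : ∀ᵐ a ∂M x, value β a = x := hx
  by_cases hxB : x ∈ B
  · rw [Set.indicator_of_mem hxB]
    refine measureReal_congr ?_
    filter_upwards [hxE] with a ha
    have : value β a ∈ B := ha ▸ hxB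
    exact propext ⟨fun h => ⟨h, this⟩, fun h => h.1⟩
  · have hsub : D ∩ value β ⁻¹' B ⊆ (expansions β x)ᶜ := fun a ha hax => hxB (by
      have hax : value β a = x := hax
      exact hax ▸ ha.2)
    rw [Set.indicator_of_notMem hxB, Measure.real, measure_mono_null hsub hx, ENNReal.toReal_zero]

lemma IsDisintegration.ae_eq {β : ℝ} (h1 : 1 < β) {M N : ℝ → Measure Seq}
    (hM : IsDisintegration β M) (hN : IsDisintegration β N) : ∀ᵐ x ∂convolution β, M x = N x := by
  have hint : ∀ {K : ℝ → Measure Seq}, IsDisintegration β K → ∀ {D : Set Seq}, MeasurableSet D →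
      Integrable (fun x => (K x).real D) (convolution β) := fun hK D hD => by
    simpa only [integral_indicator_one hD] using
      hK.integrable_base (D.indicator 1) ((integrable_const (1 : ℝ)).indicator hD)
  have hcyl : ∀ D ∈ cylinders, ∀ᵐ x ∂convolution β, (M x).real D = (N x).real D := by
    intro D hD
    have hDm : MeasurableSet D := by
      rcases hD with rfl | ⟨a, n, rfl⟩
      · exact MeasurableSet.empty
      · exact measurableSet_cylinder a n
    refine (hint hM hDm).ae_eq_of_forall_setIntegral_eq _ _ (hint hN hDm) fun B hB _ => ?_
    rw [hM.setIntegral_eq h1 hDm hB, hN.setIntegral_eq h1 hDm hB]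
  filter_upwards [(ae_ball_iff countable_cylinders).2 hcyl, hM.isProbabilityMeasure,
    hN.isProbabilityMeasure] with x hx hMx hNx
  refine measure_ext_cylinder fun a n => ?_
  have := hx _ (Or.inr ⟨a, n, rfl⟩)
  rwa [Measure.real, Measure.real, ENNReal.toReal_eq_toReal_iff' (by simp) (by simp)] at this

lemma restrict_interval_absolutelyContinuous {β : ℝ} (h1 : 1 < β) (h2 : β < 2)
    (hc : totalSize β ≠ 0) : volume.restrict (interval β) ≪ convolution β := by
  have hm := measurable_fibreSize h1 h2
  have hI : MeasurableSet (interval β) := measurableSet_Icc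
  have h : volume.restrict (interval β) ≪ totalSize β • convolution β := by
    rw [totalSize_smul_convolution h1 h2]
    refine (withDensity_absolutelyContinuous' hm.aemeasurable
      ((ae_fibreSize_pos h1 h2 hc).mono fun x hx => hx.ne')).trans ?_
    rw [← restrict_withDensity hI]
    exact Measure.restrict_le_self.absolutelyContinuous
  exact h.trans Measure.smul_absolutelyContinuous

end BetaExpansion

theorem theorem4p1 (β : ℝ) (hβ : β ∈ Set.Ioo (1 : ℝ) 2) :
    ((∀ᵐ x ∂volume.restrict (BetaExpansion.interval β),
        0 < BetaExpansion.hausdorff (BetaExpansion.dimension β)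
          (BetaExpansion.expansions β x)) ↔
      BetaExpansion.HasBoundedDensity β) ∧
    (BetaExpansion.HasBoundedDensity β →
      (∀ᵐ x ∂volume.restrict (BetaExpansion.interval β),
        BetaExpansion.hausdorff (BetaExpansion.dimension β)
          (BetaExpansion.expansions β x) < ∞) ∧
      BetaExpansion.IsDisintegration β (BetaExpansion.normalisedHausdorff β) ∧
      ∀ M : ℝ → Measure BetaExpansion.Seq, BetaExpansion.IsDisintegration β M →
        ∀ᵐ x ∂volume.restrict (BetaExpansion.interval β),
          M x = BetaExpansion.normalisedHausdorff β x) := by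
  obtain ⟨h1, h2⟩ := hβ
  refine ⟨⟨fun hpos => ?_, fun hb => ?_⟩, fun hb => ?_⟩
  · refine BetaExpansion.hasBoundedDensity_of_totalSize_ne_zero h1 h2 fun hc => ?_
    have hzero : ∀ᵐ x, BetaExpansion.fibreSize β x = 0 :=
      (lintegral_eq_zero_iff (BetaExpansion.measurable_fibreSize h1 h2)).1 hc
    have : (ae (volume.restrict (BetaExpansion.interval β))).NeBot := by
      rw [ae_neBot, Ne, Measure.restrict_eq_zero]
      simp [BetaExpansion.interval, h1]
    obtain ⟨x, hx, hx0⟩ := (hpos.and (ae_restrict_of_ae hzero)).exists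
    exact hx.ne' hx0
  · exact BetaExpansion.ae_fibreSize_pos h1 h2
      (BetaExpansion.totalSize_ne_zero_of_hasBoundedDensity h1 h2 hb)
  · have hN := BetaExpansion.isDisintegration_normalisedHausdorff h1 h2 hb
    refine ⟨ae_restrict_of_ae (BetaExpansion.ae_fibreSize_lt_top h1 h2), hN, fun M hM => ?_⟩
    exact (BetaExpansion.restrict_interval_absolutelyContinuous h1 h2
      (BetaExpansion.totalSize_ne_zero_of_hasBoundedDensity h1 h2 hb)).ae_le
      (hM.ae_eq h1 hN)
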